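/- **Setting.** Let $K\ge 3$, $\mathcal A=\{1,\dots,K\}$, and let $\mathcal S$ be a finite set. Let $P_1\neq P_2$ be ergodic (irreducible and aperiodic) transition probability matrices on $\mathcal S$ such that $P_1(j|i)>0$ if and only if $P_2(j|i)>0$, for all $i,j\in\mathcal S$; both are known. The arms $a\in\mathcal A$ carry independent Markov chains $(X^a_t)_{t\ge 0}$ on $\mathcal S$ that evolve at every time instant, whether or not they are observed. Under hypothesis $\mathcal H_h$ ($h\in\mathcal A$ is the odd arm), arm $a$ has transition matrix $P_h^a$, where $P_h^h=P_1$ and $P_h^a=P_2$ for $a\ne h$; the law $\nu_a$ of $X_0^a$ does not depend on $h$. Let $\eta\in(0,1]$. At times $t=0,\dots,K-1$ arm $t+1$ is observed. At each time $t\ge K$ a policy, on the basis of the history of intended arms, pulled arms and observations at the times before $t$, either stops and declares an arm to be the odd one, or chooses (possibly at random) an intended arm $B_t$. In the latter case the arm actually pulled is $A_t$, with $P(A_t=a\mid B_t=b)=\frac{\eta}{K}+(1-\eta)\mathbb I_{\{a=b\}}$ independently of everything else in the past and of the arms, and $A_t$ and $\bar X_t=X_t^{A_t}$ are observed. Let $P_h^\pi$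 be the law under the policy $\pi$ and $\mathcal H_h$, $\tau(\pi)$ the stopping time, and $\theta(\pi)$ the declared arm; a policy that never stops counts as making an error. For $\epsilon>0$ let $$\Pi(\epsilon)=\{\pi:\ P^\pi_h(\theta(\pi)\ne h)\le\epsilon\ \text{ for all } h\in\mathcal A\}.$$ For $t\ge K$ let $d_a(t)\geq 1$ be the time elapsed at time $t$ since arm $a$ was last pulled, and $i_a(t)$ the state that was then observed, so that $\underline d(K)=(K,K-1,\dots,1)$. Let $\mathbb S$ be the set of pairs $(\underline d,\underline i)$ with $\underline d\in\{1,2,\dots\}^K$, exactly one $d_a$ equal to $1$, and $\underline i\in\mathcal S^K$. For a conditional distribution $\lambda(\cdot|\underline d,\underline i)$ on $\mathcal A$ given $(\underline d,\underline i)\in\mathbb S$, let $\mu^{\lambda}=\mu^\lambda_h$ be the stationary distribution of the Markov chain $(\underline d(t),\underline i(t))$ that arises under $\mathcal H_h$ when $B_t$ is drawn from $\lambda(\cdot|\underline d(t),\underline i(t))$, and let $$\nu^\lambda_h(\underline d,\underline i,a)=\mu^\lambda_h(\underline d,\underline i)\Big(\frac{\eta}{K}+(1-\eta)\lambda(a|\underline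 d,\underline i)\Big),\qquad V_h(\lambda)=\min_{h'\ne h}\sum_{(\underline d,\underline i)\in\mathbb S}\sum_{a=1}^K\nu^\lambda_h(\underline d,\underline i,a)\,D\big((P_h^a)^{d_a}(\cdot|i_a)\,\big\|\,(P_{h'}^a)^{d_a}(\cdot|i_a)\big),$$ where $D$ is relative entropy, and $R^*_h=\sup_\lambda V_h(\lambda)$. For $\delta>0$ and each $h\in\mathcal A$ fix any $\lambda_{h,\delta}$ with $V_h(\lambda_{h,\delta})\ge R^*_h/(1+\delta)$. Let $Z_{hh'}(n)$ be the log-likelihood ratio, under $\mathcal H_h$ with respect to $\mathcal H_{h'}$, of the history available at time $n\geq K$: $$Z_{hh'}(n)=\sum_{a=1}^K\log\frac{P_h(X^a_{a-1})}{P_{h'}(X^a_{a-1})}+\sum_{K\le t<n}\log\frac{(P_h^{A_t})^{d_{A_t}(t)}(\bar X_t|i_{A_t}(t))}{(P_{h'}^{A_t})^{d_{A_t}(t)}(\bar X_t|i_{A_t}(t))},$$ where $P_h(X^a_{a-1})$ is the probability under $\mathcal H_h$ of the observed value of $X^a_{a-1}$, and let $M_h(n)=\min_{h'\ne h}Z_{hh'}(n)$.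 For $L>0$ the policy $\pi^\star(L,\delta)$ does the following at each time $n\ge K$: it lets $\theta(n)$ be a maximiser of $h\mapsto M_h(n)$, chosen uniformly at random among all maximisers; if $M_{\theta(n)}(n)\ge\log((K-1)L)$, it stops and declares $\theta(n)$; otherwise it draws $B_n$ from $\lambda_{\theta(n),\delta}(\cdot|\underline d(n),\underline i(n))$. **Lemma.** Let $\epsilon>0$ and $L=1/\epsilon$. Then $\pi^\star(L,\delta)\in\Pi(\epsilon)$ for every $\delta>0$. -/

import Mathlib

open MeasureTheory ProbabilityTheory
open scoped ENNReal

namespace RestlessOddArm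

noncomputable section

/-! ### Transition matrices

Entry `P i j` of a row-stochastic matrix is the transition probability `P(j | i)`. -/

/-- The transition matrix `P` is ergodic: irreducible and aperiodic (the greatest common divisor of
the possible return times to each state is `1`). -/
def IsErgodic {S : Type*} [Fintype S] [DecidableEq S] (P : Matrix.rowStochastic ℝ S) : Prop :=
  (P : Matrix S S ℝ).IsIrreducible ∧
    ∀ (i : S) (k : ℕ),
      (∀ n : ℕ, 1 ≤ n → 0 < ((P : Matrix S S ℝ) ^ n) i i → k ∣ n) → k = 1

/-- The probability distribution `P(· | i)` on the state space. -/
def row {S : Type*} [Fintype S] [DecidableEq S] (P : Matrix.rowStochastic ℝ S) (i : S) : PMF S :=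
  PMF.ofFintype (fun j => ENNReal.ofReal ((P : Matrix S S ℝ) i j)) <| by
    rw [← ENNReal.ofReal_sum_of_nonneg
      (fun j _ => Matrix.nonneg_of_mem_rowStochastic P.2),
      Matrix.sum_row_of_mem_rowStochastic P.2, ENNReal.ofReal_one]

/-- The product distribution: independent coordinates, the `a`-th one with distribution `p a`. -/
def prodPMF {K : ℕ} {S : Type*} [Fintype S] (p : Fin K → PMF S) : PMF (Fin K → S) :=
  PMF.ofFintype (fun x => ∏ a, p a (x a)) <| by
    classical
    have h : ∀ a, ∑ j, p a j = 1 := fun a => by rw [← tsum_fintype (L := .unconditional S), (p a).tsum_coe]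
    rw [← Fintype.prod_sum (fun a j => p a j)]
    simp [h]

/-! ### The model -/

/-- The data of the odd-arm problem with `K` restless arms (arm `a : Fin K` is arm `a + 1` in
one-based numbering): the transition matrix `P₁` of the odd arm, the transition matrix `P₂` of all
the other arms, the distribution `init a` of the state of arm `a` at time `0` (the same under all
hypotheses), and the trembling hand parameter `η ∈ (0, 1]`. -/
structure Model (K : ℕ) (S : Type*) [Fintype S] [DecidableEq S] where
  P₁ : Matrix.rowStochastic ℝ S
  P₂ : Matrix.rowStochastic ℝ S
  init : Fin K → PMF S
  η : ℝ
  eta_pos : 0 < η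
  eta_le_one : η ≤ 1

/-- What the decision maker has seen when a decision is due: `start x` is the history at time `K`,
where the arms `0, …, K - 1` have been observed once each, arm `a` at time `a` in state `x a`;
`next H b a x` is the history `H` followed by one more time instant at which arm `b` was the
intended one, arm `a` was the one actually pulled, and state `x` was observed on it. -/
inductive History (K : ℕ) (S : Type*) where
  | start (x : Fin K → S) : History K S
  | next (H : History K S) (b a : Fin K) (x : S) : History K S

/-- A policy. On the basis of the history, it either stops (`stops H`) and declares an arm drawn from
`declare H` to be the odd one, or goes on with an intended arm drawn from `pull H`. (The value of
`declare` where the policy does not stop, and that of `pull` after it has stopped, are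
irrelevant.) -/
structure Policy (K : ℕ) (S : Type*) where
  stops : History K S → Prop
  declare : History K S → PMF (Fin K)
  pull : History K S → PMF (Fin K)

/-- What happens at one time instant: the states of all the arms, the arm that the policy would
declare if it stopped now, the intended arm and the arm actually pulled. -/
structure Step (K : ℕ) (S : Type*) where
  state : Fin K → S
  guess : Fin K
  intended : Fin K
  pulled : Fin K

instance {K : ℕ} {S : Type*} : MeasurableSpace (Step K S) := ⊤

instance {K : ℕ} {S : Type*} : DiscreteMeasurableSpace (Step K S) := ⟨fun _ => trivial⟩

instance {K : ℕ} {S : Type*} [Finite S] : Finite (Step K S) :=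
  Finite.of_injective
    (fun s : Step K S => (s.state, s.guess, s.intended, s.pulled))
    (by rintro ⟨⟩ ⟨⟩ h; simpa using h)

/-- The history at time `K + m` along a trajectory `ω`. -/
def historyAt {K : ℕ} {S : Type*} (ω : ℕ → Step K S) : ℕ → History K S
  | 0 => .start fun a => (ω a).state a
  | m + 1 => .next (historyAt ω m) (ω (K + m)).intended (ω (K + m)).pulled
      ((ω (K + m)).state (ω (K + m)).pulled)

/-! ### Delays and last observed states -/

/-- The pairs of a vector of delays and a vector of last observed states: all delays are at least
`1`, and exactly one of them is equal to `1`. -/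
def DelayState (K : ℕ) (S : Type*) : Type _ :=
  {s : (Fin K → ℕ) × (Fin K → S) // (∀ a, 1 ≤ s.1 a) ∧ ∃! a, s.1 a = 1}

namespace DelayState

variable {K : ℕ} {S : Type*}

def delay (s : DelayState K S) : Fin K → ℕ := s.1.1

def last (s : DelayState K S) : Fin K → S := s.1.2

/-- At time `K`: the delays are `(K, K - 1, …, 1)`. -/
def start [NeZero K] (x : Fin K → S) : DelayState K S :=
  ⟨(fun a => K - a, x), fun a => by have := a.2; simp only; omega, by
    have hK : 0 < K := Nat.pos_of_ne_zero (NeZero.ne K)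
    refine ⟨⟨K - 1, by omega⟩, by simp only; omega, fun a ha => ?_⟩
    have := a.2
    simp only at ha
    ext
    simp only
    omega⟩

/-- The update after arm `a` is pulled and state `x` is observed on it. -/
def update (s : DelayState K S) (a : Fin K) (x : S) : DelayState K S :=
  ⟨(fun a' => if a' = a then 1 else s.delay a' + 1, fun a' => if a' = a then x else s.last a'),
    fun a' => by simp only; split <;> omega, by
    refine ⟨a, by simp, fun a' ha => ?_⟩
    by_contra hne
    have := s.2.1 a'
    simp only [hne, if_false, delay] at ha
    omega⟩

end DelayState

/-- The delays and last observed states given by a history. -/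
def History.delayState {K : ℕ} [NeZero K] {S : Type*} : History K S → DelayState K S
  | .start x => .start x
  | .next H _ a x => H.delayState.update a x

namespace Model

variable {K : ℕ} {S : Type*} [Fintype S] [DecidableEq S] (M : Model K S)

/-- The transition matrix of arm `a` under the hypothesis that `h` is the odd arm. -/
def P (h a : Fin K) : Matrix.rowStochastic ℝ S := if a = h then M.P₁ else M.P₂

/-- The trembling hand: the distribution of the arm actually pulled when `b` is intended. -/
def tremble (b : Fin K) : PMF (Fin K) :=
  PMF.ofFintype
    (fun a => ENNReal.ofReal (M.η / K + (1 - M.η) * if a = b then 1 else 0)) <| by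
    have h1 := M.eta_pos
    have h2 := M.eta_le_one
    have hK : (K : ℝ) ≠ 0 := by
      have := b.pos
      positivity
    rw [← ENNReal.ofReal_sum_of_nonneg, Finset.sum_add_distrib, ← Finset.mul_sum]
    · simp [mul_div_cancel₀ _ hK]
    · intro a _
      have : 0 ≤ 1 - M.η := by linarith
      split <;> positivity

/-! ### The law of the trajectory under a policy and a hypothesis -/

/-- The joint distribution at time `t` of (guess, intended arm, pulled arm), given the earlier
part of the trajectory `ω`. At the times `t < K` arm `t` is observed. -/
def selection (π : Policy K S) (ω : ℕ → Step K S) (t : ℕ) : PMF (Fin K × Fin K × Fin K) :=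
  if ht : t < K then PMF.pure (⟨t, ht⟩, ⟨t, ht⟩, ⟨t, ht⟩)
  else
    let H := historyAt ω (t - K)
    (π.declare H).bind fun g => (π.pull H).bind fun b => (M.tremble b).map fun a => (g, b, a)

/-- A trajectory up to time `n`, extended to all times by its last value. -/
def extend {n : ℕ} (p : (i : Finset.Iic n) → Step K S) : ℕ → Step K S :=
  fun i => p ⟨min i n, Finset.mem_Iic.2 (min_le_right i n)⟩

/-- The distribution of what happens at time `n + 1`, given the trajectory up to time `n`: each arm
moves, independently of the others, according to its transition matrix (whether it was pulled or
not), and the arm to be pulled is selected on the basis of the history only. -/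
def stepPMF (π : Policy K S) (h : Fin K) (n : ℕ) (p : (i : Finset.Iic n) → Step K S) :
    PMF (Step K S) :=
  (prodPMF fun a => row (M.P h a) ((extend p n).state a)).bind fun x =>
    (M.selection π (extend p) (n + 1)).map fun c => ⟨x, c.1, c.2.1, c.2.2⟩

def stepKernel (π : Policy K S) (h : Fin K) (n : ℕ) :
    Kernel ((i : Finset.Iic n) → Step K S) (Step K S) :=
  Kernel.ofFunOfCountable fun p => (M.stepPMF π h n p).toMeasure

instance (π : Policy K S) (h : Fin K) (n : ℕ) : IsMarkovKernel (M.stepKernel π h n) :=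
  ⟨fun p => by
    change IsProbabilityMeasure (M.stepPMF π h n p).toMeasure
    infer_instance⟩

/-- What happens at time `0`. -/
def initialPMF [NeZero K] : PMF (Step K S) :=
  (prodPMF M.init).map fun x => ⟨x, 0, 0, 0⟩

/-- The law of the trajectory under the policy `π` when `h` is the odd arm. -/
def law [NeZero K] (π : Policy K S) (h : Fin K) : Measure (ℕ → Step K S) :=
  Kernel.trajMeasure (X := fun _ => Step K S) M.initialPMF.toMeasure (M.stepKernel π h)

end Model

/-- The stopping time of the policy `π`; it is `⊤` if the policy never stops. -/
def Policy.stoppingTime {K : ℕ} {S : Type*} (π : Policy K S) (ω : ℕ → Step K S) : ℕ∞ :=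
  ⨅ (m : ℕ) (_ : π.stops (historyAt ω m)), ((K + m : ℕ) : ℕ∞)

/-- The policy `π` stops and declares arm `h`. -/
def Policy.declares {K : ℕ} {S : Type*} (π : Policy K S) (ω : ℕ → Step K S) (h : Fin K) : Prop :=
  ∃ n : ℕ, π.stoppingTime ω = n ∧ (ω n).guess = h

namespace Model

variable {K : ℕ} [NeZero K] {S : Type*} [Fintype S] [DecidableEq S] (M : Model K S)

/-- `Π(ε)`: the policies that fail to stop and declare the odd arm with probability at most `ε`,
wherever the odd arm is. -/
def policiesWithError (ε : ℝ) : Set (Policy K S) :=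
  {π | ∀ h : Fin K, M.law π h {ω | ¬ π.declares ω h} ≤ ENNReal.ofReal ε}

/-! ### Stationary randomised strategies and the constant `R*` -/

/-- The transition probabilities of delays and last observed states when the intended arms are
drawn from `lam (· | delays, last observed states)` and `h` is the odd arm. -/
def srsStep (h : Fin K) (lam : DelayState K S → PMF (Fin K)) (s : DelayState K S) :
    PMF (DelayState K S) :=
  (lam s).bind fun b => (M.tremble b).bind fun a =>
    (row (M.P h a ^ s.delay a) (s.last a)).map fun x => s.update a x

/-- `μ` is a stationary distribution of the chain with transition probabilities `srsStep`. -/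
def IsStationary (h : Fin K) (lam : DelayState K S → PMF (Fin K))
    (μ : DelayState K S → ℝ≥0∞) : Prop :=
  ∑' s, μ s = 1 ∧ ∀ s', ∑' s, μ s * M.srsStep h lam s s' = μ s'

/-- The (unique) stationary distribution. -/
def stationary (h : Fin K) (lam : DelayState K S → PMF (Fin K)) : DelayState K S → ℝ≥0∞ :=
  Classical.epsilon (M.IsStationary h lam)

/-- The ergodic state-action occupancy measure. -/
def occupancy (h : Fin K) (lam : DelayState K S → PMF (Fin K)) (s : DelayState K S) (a : Fin K) :
    ℝ≥0∞ :=
  M.stationary h lam s * ENNReal.ofReal (M.η / K + (1 - M.η) * (lam s a).toReal)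

/-- The relative entropy `D(P(· | i) ‖ Q(· | i))`. -/
def relEntropy (P Q : Matrix.rowStochastic ℝ S) (i : S) : ℝ :=
  ∑ j, (P : Matrix S S ℝ) i j * Real.log ((P : Matrix S S ℝ) i j / (Q : Matrix S S ℝ) i j)

/-- The relative entropy between the observation laws under `h` and `h'` when arm `a` is pulled. -/
def divergence (h h' : Fin K) (s : DelayState K S) (a : Fin K) : ℝ :=
  if a = h then relEntropy (M.P₁ ^ s.delay a) (M.P₂ ^ s.delay a) (s.last a)
  else if a = h' then relEntropy (M.P₂ ^ s.delay a) (M.P₁ ^ s.delay a) (s.last a)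
  else 0

/-- `min_{h' ≠ h} ∑_{(d, i)} ∑_a ν^λ(d, i, a) k_{hh'}(d, i, a)`. -/
def value (h : Fin K) (lam : DelayState K S → PMF (Fin K)) : ℝ≥0∞ :=
  ⨅ h' : {h' : Fin K // h' ≠ h},
    ∑' s, ∑ a, M.occupancy h lam s a * ENNReal.ofReal (M.divergence h h' s a)

/-- The constant `R*(P₁, P₂)`, computed with odd arm `h`. -/
def optimalValue (h : Fin K) : ℝ≥0∞ := ⨆ lam : DelayState K S → PMF (Fin K), M.value h lam

/-- The stationary randomised strategy `lam` attains at least `R* / (1 + δ)` for odd arm `h`. -/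
def IsNearOptimal (δ : ℝ) (h : Fin K) (lam : DelayState K S → PMF (Fin K)) : Prop :=
  M.optimalValue h / ENNReal.ofReal (1 + δ) ≤ M.value h lam

/-! ### The policy `π*(L, δ)` -/

/-- The law of the first observation of arm `a`, made at time `a`, when `h` is the odd arm. -/
def firstObservation (h a : Fin K) : PMF S := (M.init a).bind (row (M.P h a ^ (a : ℕ)))

/-- The log-likelihood ratio of the history under the hypothesis `h` with respect to the
hypothesis `h'`. (The terms for the choice of the arms cancel.) -/
def llr (h h' : Fin K) : History K S → ℝ
  | .start x => ∑ a, Real.log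
      ((M.firstObservation h a (x a)).toReal / (M.firstObservation h' a (x a)).toReal)
  | .next H _ a x => llr h h' H +
      Real.log
        (((M.P h a ^ H.delayState.delay a : Matrix.rowStochastic ℝ S) : Matrix S S ℝ)
            (H.delayState.last a) x /
          ((M.P h' a ^ H.delayState.delay a : Matrix.rowStochastic ℝ S) : Matrix S S ℝ)
            (H.delayState.last a) x)

/-- `M_h = min_{h' ≠ h} Z_{hh'}`. -/
def minLlr (h : Fin K) (H : History K S) : ℝ := ⨅ h' : {h' : Fin K // h' ≠ h}, M.llr h h' H

/-- The arms at which `M_h` is maximal. -/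
def bestArms (H : History K S) : Finset (Fin K) :=
  open Classical in Finset.univ.filter fun g => ∀ g', M.minLlr g' H ≤ M.minLlr g H

lemma bestArms_nonempty (H : History K S) : (M.bestArms H).Nonempty := by
  obtain ⟨g, -, hg⟩ := Finset.exists_max_image Finset.univ (fun g => M.minLlr g H)
    Finset.univ_nonempty
  exact ⟨g, by simpa [bestArms] using hg⟩

/-- The guess `θ`: a maximiser of `M_h`, ties being resolved uniformly at random. -/
def guess (H : History K S) : PMF (Fin K) :=
  PMF.uniformOfFinset (M.bestArms H) (M.bestArms_nonempty H)

/-- The policy `π*(L, δ)`, where `lam h` is the near-optimal stationary randomised strategy chosen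
for odd arm `h` and for `δ`: stop and declare the guess `θ` if `M_θ ≥ log ((K - 1) L)`, otherwise
draw the intended arm from `lam θ (· | delays, last observed states)`. -/
def piStar (L : ℝ) (lam : Fin K → DelayState K S → PMF (Fin K)) : Policy K S where
  stops H := ∃ g ∈ M.bestArms H, Real.log (((K : ℝ) - 1) * L) ≤ M.minLlr g H
  declare H := M.guess H
  pull H := (M.guess H).bind fun g => lam g H.delayState

end Model

end

end RestlessOddArm

/-! Let `h` be the odd arm. An error means either that the policy never stops or that it declares
some `g ≠ h`.

False declarations are bounded by a change of measure. If `g` is declared on a history `H`, then `g`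
maximises `minLlr` and reaches the threshold, so `llr g h H ≥ log ((K - 1) L)`: the likelihood of
`H` under `h` is at most `1 / ((K - 1) L)` times that under `g`. Summing over the disjoint possible
stopping times bounds the probability of declaring `g` under `h` by `1 / ((K - 1) L) = ε / (K - 1)`
(`law_declares_le`), and there are `K - 1` wrong arms.

Almost sure stopping (`law_never_stops`) follows once the expected square root of the likelihood
ratio of each `h' ≠ h` with respect to `h` tends to `0`. An observation multiplies its conditional
expectation by a sum of geometric means `√(p q)`, which is at most `1`, and less than `1` if the two
rows differ. The matrices `P₁ ^ d` and `P₂ ^ d` may agree for `d > 1`, so arm `h` should be observed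
at consecutive times, along a path to a state where the rows of `P₁` and `P₂` differ. Irreducibility
provides the path and the trembling hand makes each such pull have probability at least `η / K`
under any policy. As `S` is finite, a fixed number of steps contracts by a fixed factor from every
history (`exists_contraction`).

Both arguments need the law of the observed history, whereas `law` describes the states of all arms.
`lintegral_historyAt` supplies it: given the history, the arms are independent and arm `a` has law
`P ^ d` started from its last observed state, with `d` its delay. Trajectories run on after a stop,
so `historyPMF` ignores stopping. -/

namespace RestlessOddArm

noncomputable section

/-! ### Expectations under probability mass functions -/

section Expect

variable {α β γ : Type*}

/-- The expectation of `f` under `p`. -/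
def expect (p : PMF α) (f : α → ℝ≥0∞) : ℝ≥0∞ := ∑' x, p x * f x

lemma expect_bind (p : PMF α) (q : α → PMF β) (f : β → ℝ≥0∞) :
    expect (p.bind q) f = expect p fun x => expect (q x) f := by
  simp only [expect, PMF.bind_apply, ← ENNReal.tsum_mul_right, ← ENNReal.tsum_mul_left]
  rw [ENNReal.tsum_comm]
  simp only [mul_assoc]

lemma expect_pure (x : α) (f : α → ℝ≥0∞) : expect (PMF.pure x) f = f x := by
  rw [expect, tsum_eq_single x]
  · simp
  · intro y hy
    simp [PMF.pure_apply, hy]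

lemma expect_map (p : PMF α) (g : α → β) (f : β → ℝ≥0∞) :
    expect (p.map g) f = expect p fun x => f (g x) := by
  simp only [PMF.map, expect_bind, Function.comp, expect_pure]

lemma expect_comm (p : PMF α) (q : PMF β) (f : α → β → ℝ≥0∞) :
    (expect p fun x => expect q fun y => f x y) = expect q fun y => expect p fun x => f x y := by
  simp only [expect, ← ENNReal.tsum_mul_left]
  rw [ENNReal.tsum_comm]
  simp only [mul_left_comm]

lemma expect_const (p : PMF α) (c : ℝ≥0∞) : (expect p fun _ => c) = c := by
  rw [expect, ENNReal.tsum_mul_right, p.tsum_coe, one_mul]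

lemma expect_mul_left (p : PMF α) (c : ℝ≥0∞) (f : α → ℝ≥0∞) :
    (expect p fun x => c * f x) = c * expect p f := by
  simp only [expect, ← ENNReal.tsum_mul_left, mul_left_comm]

lemma expect_mono (p : PMF α) {f g : α → ℝ≥0∞} (h : ∀ x, f x ≤ g x) : expect p f ≤ expect p g :=
  ENNReal.tsum_le_tsum fun x => mul_le_mul_right (h x) _

lemma expect_congr (p : PMF α) {f g : α → ℝ≥0∞} (h : ∀ x, p x ≠ 0 → f x = g x) :
    expect p f = expect p g := by
  refine tsum_congr fun x => ?_
  by_cases hx : p x = 0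
  · simp [hx]
  · rw [h x hx]

lemma expect_ext {p q : PMF α} (h : ∀ f, expect p f = expect q f) : p = q := by
  classical
  ext x
  have := h fun y => if y = x then 1 else 0
  simpa [expect] using this

lemma lintegral_toMeasure [MeasurableSpace α] [DiscreteMeasurableSpace α] [Countable α]
    (p : PMF α) (f : α → ℝ≥0∞) : ∫⁻ x, f x ∂p.toMeasure = expect p f := by
  rw [lintegral_countable']
  refine tsum_congr fun x => ?_
  rw [PMF.toMeasure_apply_singleton _ _ (measurableSet_singleton x), mul_comm]

/-- If the value `x₀` has weight at least `q` and the total weight is at most `1`, a function bounded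
by `1` that is at most `c` at `x₀` has weighted sum at most `1 - q * (1 - c)`. -/
lemma tsum_mul_le_of_le_apply {w : α → ℝ≥0∞} (hw : ∑' x, w x ≤ 1) {q c : ℝ≥0∞} {x₀ : α}
    (hq : q ≤ w x₀) (hc : c ≤ 1) {f : α → ℝ≥0∞} (hf : ∀ x, f x ≤ 1) (hf₀ : f x₀ ≤ c) :
    ∑' x, w x * f x ≤ 1 - q * (1 - c) := by
  classical
  have h2 : ∑' x, w x * f x + q * (1 - c) ≤ 1 := by
    calc ∑' x, w x * f x + q * (1 - c)
        ≤ ∑' x, w x * f x + ∑' x, w x * if x = x₀ then 1 - c else 0 := by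
          simp only [mul_ite, mul_zero, tsum_ite_eq]
          gcongr
      _ = ∑' x, w x * (f x + if x = x₀ then 1 - c else 0) := by
          simp only [mul_add, ENNReal.tsum_add]
      _ ≤ ∑' x, w x * 1 := by
          refine ENNReal.tsum_le_tsum fun x => mul_le_mul_right ?_ _
          split_ifs with h
          · subst h
            calc f x + (1 - c) ≤ c + (1 - c) := by gcongr
              _ = 1 := add_tsub_cancel_of_le hc
          · simpa using hf x
      _ ≤ 1 := by simpa using hw
  refine ENNReal.le_sub_of_add_le_right ?_ h2
  exact ne_top_of_le_ne_top ENNReal.one_ne_top (le_trans le_add_self h2)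

lemma one_sub_mul_one_sub_lt_one {q c : ℝ≥0∞} (hq : q ≠ 0) (hc : c < 1) : 1 - q * (1 - c) < 1 :=
  ENNReal.sub_lt_self ENNReal.one_ne_top one_ne_zero
    (mul_ne_zero hq (tsub_pos_of_lt hc).ne')

end Expect

/-! ### Product distributions and rows of transition matrices -/

section Product

variable {K : ℕ} {S T : Type*} [Fintype S] [Fintype T]

lemma prodPMF_apply (p : Fin K → PMF S) (x : Fin K → S) : prodPMF p x = ∏ a, p a (x a) := rfl

/-- Distributivity of a product over sums: coordinatewise moves preserve independence. -/
lemma prodPMF_bind (p : Fin K → PMF S) (q : Fin K → S → PMF T) :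
    ((prodPMF p).bind fun z => prodPMF fun a => q a (z a)) =
      prodPMF fun a => (p a).bind (q a) := by
  classical
  ext y
  simp only [PMF.bind_apply, prodPMF_apply, tsum_fintype, ← Finset.prod_mul_distrib]
  exact (Fintype.prod_sum fun a j => p a j * q a j (y a)).symm

lemma prodPMF_pure (x : Fin K → S) : (prodPMF fun a => PMF.pure (x a)) = PMF.pure x := by
  classical
  ext y
  simp only [prodPMF_apply, PMF.pure_apply]
  split_ifs with h
  · simp [h]
  · obtain ⟨a, ha⟩ := Function.ne_iff.1 h
    exact Finset.prod_eq_zero (Finset.mem_univ a) (by simp [ha])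

lemma prodPMF_map (p : Fin K → PMF S) (g : Fin K → S → T) :
    ((prodPMF p).map fun z a => g a (z a)) = prodPMF fun a => (p a).map (g a) := by
  simp only [PMF.map, ← prodPMF_bind]
  congr 1
  ext1 z
  exact (prodPMF_pure _).symm

lemma prodPMF_eq_bind_update (p : Fin K → PMF S) (a : Fin K) :
    prodPMF p = (p a).bind fun x => prodPMF (Function.update p a (PMF.pure x)) := by
  classical
  ext z
  rw [PMF.bind_apply, tsum_eq_single (z a)]
  · simp only [prodPMF_apply]
    rw [← Finset.mul_prod_erase _ _ (Finset.mem_univ a),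
      ← Finset.mul_prod_erase _ (fun a' => (Function.update p a (PMF.pure (z a)) a') (z a'))
        (Finset.mem_univ a)]
    simp only [Function.update_self, PMF.pure_apply, if_true, one_mul]
    congr 1
    refine Finset.prod_congr rfl fun a' ha' => ?_
    rw [Function.update_of_ne (Finset.ne_of_mem_erase ha')]
  · intro x hx
    rw [prodPMF_apply, Finset.prod_eq_zero (Finset.mem_univ a), mul_zero]
    simp [PMF.pure_apply, hx.symm]

/-- Two successive independent moves of the coordinates, the intermediate value of coordinate `a`
being observed. -/
lemma expect_prodPMF_observe (p : Fin K → PMF S) (q : Fin K → S → PMF T) (a : Fin K)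
    (φ : S → (Fin K → T) → ℝ≥0∞) :
    (expect (prodPMF p) fun y => expect (prodPMF fun a' => q a' (y a')) fun y' => φ (y a) y') =
      expect (p a) fun x =>
        expect (prodPMF fun a' => if a' = a then q a' x else (p a').bind (q a')) (φ x) := by
  classical
  rw [prodPMF_eq_bind_update p a, expect_bind]
  refine expect_congr _ fun x _ => ?_
  -- Fixing the observed value turns coordinate `a` into a point mass, which makes this family a
  -- coordinatewise bind again.
  have h1 : (fun a' => if a' = a then q a' x else (p a').bind (q a')) =
      fun a' => (Function.update p a (PMF.pure x) a').bind (q a') := by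
    ext1 a'
    split_ifs with h
    · subst h; simp
    · simp [h]
  rw [h1, ← prodPMF_bind, expect_bind]
  refine expect_congr _ fun y hy => ?_
  have : y a = x := by
    by_contra hne
    refine hy (Finset.prod_eq_zero (Finset.mem_univ a) ?_)
    simp [PMF.pure_apply, hne]
  rw [this]

variable [DecidableEq S]

lemma row_apply (P : Matrix.rowStochastic ℝ S) (i j : S) :
    row P i j = ENNReal.ofReal ((P : Matrix S S ℝ) i j) := rfl

lemma entry_nonneg (P : Matrix.rowStochastic ℝ S) (i j : S) : 0 ≤ (P : Matrix S S ℝ) i j :=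
  Matrix.nonneg_of_mem_rowStochastic P.2

lemma toReal_row (P : Matrix.rowStochastic ℝ S) (i j : S) :
    (row P i j).toReal = (P : Matrix S S ℝ) i j :=
  ENNReal.toReal_ofReal (entry_nonneg P i j)

lemma row_one (i : S) : row (1 : Matrix.rowStochastic ℝ S) i = PMF.pure i := by
  ext j
  rcases eq_or_ne j i with rfl | h
  · simp [row_apply, PMF.pure_apply]
  · simp [row_apply, PMF.pure_apply, h, h.symm]

lemma row_bind_row (P Q : Matrix.rowStochastic ℝ S) (i : S) :
    (row P i).bind (row Q) = row (P * Q) i := by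
  ext j
  simp only [PMF.bind_apply, tsum_fintype, row_apply, Submonoid.coe_mul, Matrix.mul_apply]
  rw [ENNReal.ofReal_sum_of_nonneg fun k _ => mul_nonneg (entry_nonneg P i k) (entry_nonneg Q k j)]
  exact Finset.sum_congr rfl fun k _ => (ENNReal.ofReal_mul (entry_nonneg P i k)).symm

/-- Matrices with the same zero pattern have powers with the same zero pattern. -/
lemma pow_pos_iff_of_pos_iff {P Q : Matrix.rowStochastic ℝ S}
    (h : ∀ i j, 0 < (P : Matrix S S ℝ) i j ↔ 0 < (Q : Matrix S S ℝ) i j) (d : ℕ) (i j : S) :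
    0 < ((P ^ d : Matrix.rowStochastic ℝ S) : Matrix S S ℝ) i j ↔
      0 < ((Q ^ d : Matrix.rowStochastic ℝ S) : Matrix S S ℝ) i j := by
  induction d generalizing j with
  | zero => simp
  | succ d ih =>
    have key : ∀ R : Matrix.rowStochastic ℝ S,
        0 < ((R ^ (d + 1) : Matrix.rowStochastic ℝ S) : Matrix S S ℝ) i j ↔
          ∃ k, 0 < ((R ^ d : Matrix.rowStochastic ℝ S) : Matrix S S ℝ) i k ∧
            0 < (R : Matrix S S ℝ) k j := by
      intro R
      rw [pow_succ, Submonoid.coe_mul, Matrix.mul_apply, Finset.sum_pos_iff_of_nonneg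
        fun k _ => mul_nonneg (entry_nonneg _ i k) (entry_nonneg R k j)]
      refine ⟨fun ⟨k, _, hk⟩ => ⟨k, ?_⟩, fun ⟨k, h1, h2⟩ => ⟨k, Finset.mem_univ k, mul_pos h1 h2⟩⟩
      have h1 := entry_nonneg (R ^ d) i k
      have h2 := entry_nonneg R k j
      exact ⟨h1.lt_of_ne' (left_ne_zero_of_mul hk.ne'), h2.lt_of_ne' (right_ne_zero_of_mul hk.ne')⟩
    simp only [key, ih, h]

end Product

/-! ### The law of the histories -/

lemma historyAt_congr {K : ℕ} {S : Type*} {ω ω' : ℕ → Step K S} {m : ℕ}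
    (h : ∀ i < K + m, ω i = ω' i) : historyAt ω m = historyAt ω' m := by
  induction m with
  | zero => simp only [historyAt, History.start.injEq]; ext1 a; rw [h a (by omega)]
  | succ m ih => simp only [historyAt, ih fun i hi => h i (by omega), h (K + m) (by omega)]

namespace Model

open Kernel Preorder

section Trajectory

variable {K : ℕ} {S : Type*}

lemma extend_frestrictLe (n : ℕ) (ω : ℕ → Step K S) (i : ℕ) :
    extend (frestrictLe (π := fun _ => Step K S) n ω) i = ω (min i n) := rfl

lemma measurable_comp_frestrictLe [Finite S] {β : Type*} [MeasurableSpace β] (n : ℕ)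
    (F : ((i : Finset.Iic n) → Step K S) → β) :
    Measurable fun ω : ℕ → Step K S => F (frestrictLe (π := fun _ => Step K S) n ω) :=
  (measurable_of_countable F).comp (measurable_frestrictLe n)

/-- A statistic of the history at time `K + m` and of what happens then is measurable. -/
lemma measurable_historyAt [Finite S] {β : Type*} [MeasurableSpace β] (m : ℕ)
    (F : History K S → Step K S → β) :
    Measurable fun ω : ℕ → Step K S => F (historyAt ω m) (ω (K + m)) := by
  convert measurable_comp_frestrictLe (K := K) (S := S) (K + m)
    fun p => F (historyAt (extend p) m) (extend p (K + m)) using 2 with ω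
  rw [historyAt_congr (ω' := extend _) fun i hi => ?_, extend_frestrictLe, min_self]
  rw [extend_frestrictLe, min_eq_left hi.le]

end Trajectory

variable {K : ℕ} {S : Type*} [Fintype S] [DecidableEq S] (M : Model K S)

/-- The joint distribution of (guess, intended arm, pulled arm), given the history. -/
def selectionOfHistory (π : Policy K S) (H : History K S) : PMF (Fin K × Fin K × Fin K) :=
  (π.declare H).bind fun g => (π.pull H).bind fun b => (M.tremble b).map fun a => (g, b, a)

lemma selection_of_le (π : Policy K S) (ω : ℕ → Step K S) (m : ℕ) :
    M.selection π ω (K + m) = M.selectionOfHistory π (historyAt ω m) := by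
  simp [selection, selectionOfHistory]

lemma expect_stepPMF (π : Policy K S) (h : Fin K) (n : ℕ) (p : (i : Finset.Iic n) → Step K S)
    (F : Step K S → ℝ≥0∞) :
    expect (M.stepPMF π h n p) F =
      expect (prodPMF fun a => row (M.P h a) ((extend p n).state a)) fun x =>
        expect (M.selection π (extend p) (n + 1)) fun c => F ⟨x, c.1, c.2.1, c.2.2⟩ := by
  simp only [stepPMF, expect_bind, expect_map]

/-- The joint distribution of the state of arm `a` at time `min a n` and at time `n`. -/
def statePair (h : Fin K) (n : ℕ) (a : Fin K) : PMF (S × S) :=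
  ((M.init a).bind (row (M.P h a ^ min (a : ℕ) n))).bind fun z =>
    (row (M.P h a ^ (n - a)) z).map fun y => (z, y)

/-- Up to time `a` both components move together; afterwards the first, the state to be observed at
time `a`, is frozen. -/
lemma statePair_succ (h : Fin K) (n : ℕ) (a : Fin K) :
    M.statePair h (n + 1) a = (M.statePair h n a).bind fun zy =>
      (row (M.P h a) zy.2).map fun y => (if (a : ℕ) ≤ n then zy.1 else y, y) := by
  refine expect_ext fun f => ?_
  simp only [statePair, expect_bind, expect_map]
  by_cases ha : (a : ℕ) ≤ n
  · rw [min_eq_left ha, min_eq_left (by omega), Nat.succ_sub ha, pow_succ]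
    simp only [if_pos ha, ← row_bind_row, expect_bind]
  · have h1 : n - a = 0 := by omega
    have h2 : n + 1 - a = 0 := by omega
    rw [min_eq_right (by omega), min_eq_right (by omega), h1, h2, pow_succ]
    simp only [if_neg ha, ← row_bind_row, expect_bind, pow_zero, row_one, expect_pure]

variable [NeZero K]

instance (π : Policy K S) (h : Fin K) : IsProbabilityMeasure (M.law π h) := by
  unfold law; infer_instance

/-- The disintegration property of the Ionescu-Tulcea measure, as an identity of integrals. -/
lemma lintegral_law_succ (π : Policy K S) (h : Fin K) (n : ℕ)
    (F : ((i : Finset.Iic n) → Step K S) → Step K S → ℝ≥0∞) :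
    ∫⁻ ω, F (frestrictLe n ω) (ω (n + 1)) ∂M.law π h =
      ∫⁻ ω, expect (M.stepPMF π h n (frestrictLe n ω)) (F (frestrictLe n ω)) ∂M.law π h := by
  have key := map_frestrictLe_trajMeasure_compProd_eq_map_trajMeasure
    (X := fun _ => Step K S) (κ := M.stepKernel π h) (μ₀ := M.initialPMF.toMeasure) (a := n)
  have hF : Measurable fun x : ((i : Finset.Iic n) → Step K S) × Step K S => F x.1 x.2 :=
    measurable_of_countable _
  have h1 := congrArg (fun μ => ∫⁻ x, F x.1 x.2 ∂μ) key
  rw [Measure.lintegral_compProd hF, lintegral_map hF (by fun_prop),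
    lintegral_map (measurable_of_countable _) (by fun_prop)] at h1
  refine h1.symm.trans (lintegral_congr fun ω => ?_)
  exact lintegral_toMeasure _ _

lemma lintegral_law_zero (π : Policy K S) (h : Fin K) (F : Step K S → ℝ≥0∞) :
    ∫⁻ ω, F (ω 0) ∂M.law π h = expect M.initialPMF F := by
  have key : (M.law π h).map (frestrictLe (π := fun _ => Step K S) 0) =
      M.initialPMF.toMeasure.map
        (MeasurableEquiv.piUnique (fun _ : Finset.Iic 0 => Step K S)).symm := by
    rw [law, trajMeasure, Measure.map_comp _ _ (by fun_prop), traj_map_frestrictLe,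
      partialTraj_self, Measure.id_comp]
  have hF : Measurable fun p : (i : Finset.Iic 0) → Step K S => F (p ⟨0, by simp⟩) :=
    measurable_of_countable _
  have h1 := congrArg (fun μ => ∫⁻ p, F (p ⟨0, by simp⟩) ∂μ) key
  rw [lintegral_map hF (by fun_prop), lintegral_map hF (by fun_prop)] at h1
  refine h1.trans ((lintegral_congr fun s => ?_).trans (lintegral_toMeasure _ _))
  rfl

/-- The arms evolve whatever is pulled, so the selection integrates out. Keeping the state at time
`a` beside the current one makes the initial history, which samples different arms at different
times, accessible to induction. -/
lemma lintegral_statePair (π : Policy K S) (h : Fin K) (n : ℕ) (f : (Fin K → S × S) → ℝ≥0∞) :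
    ∫⁻ ω, f (fun a => ((ω (min a n)).state a, (ω n).state a)) ∂M.law π h =
      expect (prodPMF (M.statePair h n)) f := by
  induction n generalizing f with
  | zero =>
    have h1 : M.statePair h 0 = fun a => (M.init a).map fun z => (z, z) := by
      ext1 a
      refine expect_ext fun f => ?_
      simp [statePair, expect_bind, expect_map, row_one, expect_pure]
    rw [h1, ← prodPMF_map, expect_map]
    simp only [Nat.min_zero]
    rw [M.lintegral_law_zero π h fun s => f fun a => (s.state a, s.state a), initialPMF,
      expect_map]
  | succ n ih =>
    let F : ((i : Finset.Iic n) → Step K S) → Step K S → ℝ≥0∞ := fun p s =>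
      f fun a => (if (a : ℕ) ≤ n then (extend p a).state a else s.state a, s.state a)
    have h1 : ∀ ω : ℕ → Step K S,
        f (fun a => ((ω (min a (n + 1))).state a, (ω (n + 1)).state a)) =
          F (frestrictLe (π := fun _ => Step K S) n ω) (ω (n + 1)) := by
      intro ω
      simp only [F, extend_frestrictLe]
      congr 1
      ext1 a
      split_ifs with ha
      · rw [min_eq_left ha, min_eq_left (by omega)]
      · rw [min_eq_right (by omega)]
    refine (lintegral_congr h1).trans ((M.lintegral_law_succ π h n F).trans ?_)
    simp only [F]
    simp only [expect_stepPMF, expect_const, extend_frestrictLe, min_self]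
    rw [ih fun zy => expect (prodPMF fun a => row (M.P h a) (zy a).2) fun x =>
      f fun a => (if (a : ℕ) ≤ n then (zy a).1 else x a, x a)]
    have h2 : M.statePair h (n + 1) = fun a => (M.statePair h n a).bind fun zy =>
      (row (M.P h a) zy.2).map fun y => (if (a : ℕ) ≤ n then zy.1 else y, y) :=
      funext fun a => M.statePair_succ h n a
    rw [h2, ← prodPMF_bind, expect_bind]
    refine expect_congr _ fun zy _ => ?_
    rw [← prodPMF_map (fun a => row (M.P h a) (zy a).2)
      fun a y => (if (a : ℕ) ≤ n then (zy a).1 else y, y), expect_map]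

/-- The distribution of the history at the next time instant, given the history. -/
def nextHistory (π : Policy K S) (h : Fin K) (H : History K S) : PMF (History K S) :=
  (π.pull H).bind fun b => (M.tremble b).bind fun a =>
    (row (M.P h a ^ H.delayState.delay a) (H.delayState.last a)).map fun x => H.next b a x

/-- The distribution of the history at time `K + m`. -/
def historyPMF (π : Policy K S) (h : Fin K) : ℕ → PMF (History K S)
  | 0 => (prodPMF (M.firstObservation h)).map History.start
  | m + 1 => (historyPMF π h m).bind (M.nextHistory π h)

/-- The distribution of the states of all the arms, given the history. -/
def armStates (h : Fin K) (H : History K S) : PMF (Fin K → S) :=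
  prodPMF fun a => row (M.P h a ^ H.delayState.delay a) (H.delayState.last a)

lemma lintegral_historyAt_eq_prev (π : Policy K S) (h : Fin K) (m n : ℕ) (hn : K + m = n + 1)
    (f : History K S → Step K S → ℝ≥0∞) :
    ∫⁻ ω, f (historyAt ω m) (ω (K + m)) ∂M.law π h =
      ∫⁻ ω, expect (prodPMF fun a => row (M.P h a) ((ω n).state a)) (fun y =>
        expect (M.selectionOfHistory π (historyAt ω m)) fun c =>
          f (historyAt ω m) ⟨y, c.1, c.2.1, c.2.2⟩) ∂M.law π h := by
  have h1 : ∀ ω : ℕ → Step K S,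
      historyAt (extend (frestrictLe (π := fun _ => Step K S) n ω)) m = historyAt ω m :=
    fun ω => historyAt_congr fun i hi => by rw [extend_frestrictLe, min_eq_left (by omega)]
  have h2 := M.lintegral_law_succ π h n fun p s => f (historyAt (extend p) m) s
  simp only [h1, expect_stepPMF, ← hn, selection_of_le, extend_frestrictLe, min_self] at h2
  exact h2

/-- The joint law of the history at time `K + m` and of what happens at that time: given the
history, the arms are independent of each other and of the selection. -/
lemma lintegral_historyAt (π : Policy K S) (h : Fin K) (m : ℕ)
    (f : History K S → Step K S → ℝ≥0∞) :
    ∫⁻ ω, f (historyAt ω m) (ω (K + m)) ∂M.law π h =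
      expect (M.historyPMF π h m) fun H => expect (M.armStates h H) fun y =>
        expect (M.selectionOfHistory π H) fun c => f H ⟨y, c.1, c.2.1, c.2.2⟩ := by
  induction m generalizing f with
  | zero =>
    have hK : 0 < K := Nat.pos_of_ne_zero (NeZero.ne K)
    rw [M.lintegral_historyAt_eq_prev π h 0 (K - 1) (by omega)]
    have h1 : ∀ ω : ℕ → Step K S, historyAt ω 0 =
        .start fun a => (ω (min a (K - 1))).state a := by
      intro ω
      rw [historyAt]
      congr 1
      ext1 a
      rw [min_eq_left (by omega)]
    simp only [h1]
    rw [M.lintegral_statePair π h (K - 1) fun zy =>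
      expect (prodPMF fun a => row (M.P h a) (zy a).2) fun y =>
        expect (M.selectionOfHistory π (.start fun a => (zy a).1)) fun c =>
          f (.start fun a => (zy a).1) ⟨y, c.1, c.2.1, c.2.2⟩]
    have h2 : M.statePair h (K - 1) = fun a => (M.firstObservation h a).bind fun z =>
        (row (M.P h a ^ (K - 1 - a)) z).map fun y => (z, y) := by
      ext1 a
      rw [statePair, min_eq_left (by omega), firstObservation]
    rw [h2, ← prodPMF_bind, expect_bind, historyPMF, expect_map]
    refine expect_congr _ fun z _ => ?_
    rw [← prodPMF_map (fun a => row (M.P h a ^ (K - 1 - a)) (z a)) fun a y => (z a, y), expect_map]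
    -- The `K - 1 - a` moves since the observation of arm `a`, and one more to reach time `K`, make
    -- up its initial delay `K - a`.
    have h3 : M.armStates h (.start z) =
        (prodPMF fun a : Fin K => row (M.P h a ^ (K - 1 - a)) (z a)).bind fun y =>
          prodPMF fun a => row (M.P h a) (y a) := by
      rw [prodPMF_bind, armStates]
      congr 1
      ext1 a
      rw [row_bind_row, ← pow_succ, show K - 1 - (a : ℕ) + 1 = K - a by omega]
      rfl
    rw [h3, expect_bind]
  | succ m ih =>
    rw [M.lintegral_historyAt_eq_prev π h (m + 1) (K + m) (by omega)]
    simp only [historyAt]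
    rw [ih fun H s => expect (prodPMF fun a => row (M.P h a) (s.state a)) fun y =>
      expect (M.selectionOfHistory π (H.next s.intended s.pulled (s.state s.pulled))) fun c =>
        f (H.next s.intended s.pulled (s.state s.pulled)) ⟨y, c.1, c.2.1, c.2.2⟩]
    rw [historyPMF, expect_bind]
    refine expect_congr _ fun H _ => ?_
    -- The selection depends on the history alone, so it can be averaged outside the arm states; the
    -- pulled arm is then fixed when its state is revealed.
    rw [expect_comm, nextHistory]
    conv_lhs => enter [1]; rw [selectionOfHistory]
    simp only [expect_bind, expect_map, expect_const]
    refine expect_congr _ fun b _ => expect_congr _ fun a _ => ?_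
    rw [armStates, expect_prodPMF_observe _ (fun a' => row (M.P h a')) a fun x y =>
      expect (M.selectionOfHistory π (H.next b a x)) fun c =>
        f (H.next b a x) ⟨y, c.1, c.2.1, c.2.2⟩]
    refine expect_congr _ fun x _ => ?_
    congr 1
    rw [armStates]
    congr 1
    ext1 a'
    -- The pulled arm restarts with delay `1`; any other arm gains one factor of its transition
    -- matrix.
    by_cases ha : a' = a
    · simp [ha, History.delayState, DelayState.update, DelayState.delay, DelayState.last]
    · simp [ha, History.delayState, DelayState.update, DelayState.delay, DelayState.last,
        row_bind_row, pow_succ]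

end Model

/-! ### Stopping and declaring in terms of the histories -/

/-- The policy would have stopped before the history `H` was complete. -/
def History.StoppedBefore {K : ℕ} {S : Type*} (π : Policy K S) : History K S → Prop
  | .start _ => False
  | .next H _ _ _ => H.StoppedBefore π ∨ π.stops H

section Stopping

variable {K : ℕ} {S : Type*} (π : Policy K S)

lemma stoppedBefore_historyAt (ω : ℕ → Step K S) (m : ℕ) :
    (historyAt ω m).StoppedBefore π ↔ ∃ k < m, π.stops (historyAt ω k) := by
  induction m with
  | zero => simp [historyAt, History.StoppedBefore]
  | succ m ih =>
    simp only [historyAt, History.StoppedBefore, ih, Nat.lt_succ_iff_lt_or_eq, or_and_right,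
      exists_or, exists_eq_left]

/-- The policy stops at time `K + m` and declares arm `g`. -/
def DeclaresAt (m : ℕ) (g : Fin K) (ω : ℕ → Step K S) : Prop :=
  (π.stops (historyAt ω m) ∧ ¬ (historyAt ω m).StoppedBefore π) ∧ (ω (K + m)).guess = g

lemma stoppingTime_eq {ω : ℕ → Step K S} {m : ℕ} (h1 : π.stops (historyAt ω m))
    (h2 : ¬ (historyAt ω m).StoppedBefore π) : π.stoppingTime ω = (K + m : ℕ) := by
  rw [stoppedBefore_historyAt] at h2
  refine le_antisymm (iInf₂_le m h1) (le_iInf₂ fun k hk => ?_)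
  have : m ≤ k := by
    by_contra! hlt
    exact h2 ⟨k, hlt, hk⟩
  exact_mod_cast Nat.add_le_add_left this K

lemma exists_first_stop {ω : ℕ → Step K S} (h : ∃ m, π.stops (historyAt ω m)) :
    ∃ m, π.stops (historyAt ω m) ∧ ¬ (historyAt ω m).StoppedBefore π := by
  classical
  refine ⟨Nat.find h, Nat.find_spec h, fun hb => ?_⟩
  obtain ⟨k, hk, hk'⟩ := (stoppedBefore_historyAt π ω _).1 hb
  exact Nat.find_min h hk hk'

/-- Splits a declaration into events that each depend on a finite history and the guess made there.
-/
lemma declares_iff (ω : ℕ → Step K S) (g : Fin K) :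
    π.declares ω g ↔ ∃ m, DeclaresAt π m g ω := by
  constructor
  · rintro ⟨n, hn, hg⟩
    by_cases hs : ∃ m, π.stops (historyAt ω m)
    · obtain ⟨m, h1, h2⟩ := exists_first_stop π hs
      rw [stoppingTime_eq π h1 h2] at hn
      have : K + m = n := by exact_mod_cast hn
      exact ⟨m, ⟨h1, h2⟩, this ▸ hg⟩
    · have : π.stoppingTime ω = ⊤ := by
        simp only [Policy.stoppingTime, iInf_eq_top]
        exact fun m hm => absurd ⟨m, hm⟩ hs
      rw [this] at hn
      exact absurd hn.symm (ENat.natCast_ne_top n)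
  · rintro ⟨m, ⟨h1, h2⟩, hg⟩
    exact ⟨K + m, stoppingTime_eq π h1 h2, hg⟩

lemma declares_or_of_stops {ω : ℕ → Step K S} (h : ∃ m, π.stops (historyAt ω m)) :
    ∃ g, π.declares ω g := by
  obtain ⟨m, h1, h2⟩ := exists_first_stop π h
  exact ⟨_, (declares_iff π ω _).2 ⟨m, ⟨h1, h2⟩, rfl⟩⟩

lemma pairwise_disjoint_declaresAt (g : Fin K) :
    Pairwise (Function.onFun Disjoint fun m => {ω : ℕ → Step K S | DeclaresAt π m g ω}) := by
  intro m m' hne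
  refine Set.disjoint_left.2 fun ω ⟨⟨h1, h2⟩, _⟩ ⟨⟨h1', h2'⟩, _⟩ => hne ?_
  rw [stoppedBefore_historyAt] at h2 h2'
  push Not at h2 h2'
  rcases lt_trichotomy m m' with h | h | h
  · exact absurd h1 (h2' m h)
  · exact h
  · exact absurd h1' (h2 m' h)

lemma measurableSet_declaresAt [Finite S] (m : ℕ) (g : Fin K) :
    MeasurableSet {ω : ℕ → Step K S | DeclaresAt π m g ω} :=
  measurableSet_setOfPred.2 <| Model.measurable_historyAt m fun H s =>
    (π.stops H ∧ ¬ H.StoppedBefore π) ∧ s.guess = g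

end Stopping

/-- The case `q = 0` forces `p = 0`, so the junk value of the logarithm there is harmless. -/
lemma exp_log_toReal_div {p q : ℝ≥0∞} (hp : p ≠ ∞) (hq : q ≠ ∞) (h : 0 < p ↔ 0 < q) :
    q * ENNReal.ofReal (Real.exp (Real.log (p.toReal / q.toReal))) = p := by
  rcases eq_or_ne q 0 with rfl | hq0
  · simpa [eq_comm] using (not_iff_not.2 h).2 (lt_irrefl 0)
  · have hq' := ENNReal.toReal_pos hq0 hq
    have hp' := ENNReal.toReal_pos (h.2 (pos_iff_ne_zero.2 hq0)).ne' hp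
    rw [Real.exp_log (div_pos hp' hq'), ENNReal.ofReal_div_of_pos hq', ENNReal.ofReal_toReal hp,
      ENNReal.ofReal_toReal hq, ENNReal.mul_div_cancel hq0 hq]

/-! ### Common supports and the law of the declarations -/

namespace Model

variable {K : ℕ} {S : Type*} [Fintype S] [DecidableEq S] (M : Model K S)

section Support

variable {M}
variable (hsupp : ∀ i j : S, 0 < (M.P₁ : Matrix S S ℝ) i j ↔ 0 < (M.P₂ : Matrix S S ℝ) i j)
include hsupp

lemma P_pow_pos_iff (h g a : Fin K) (d : ℕ) (i j : S) :
    0 < ((M.P h a ^ d : Matrix.rowStochastic ℝ S) : Matrix S S ℝ) i j ↔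
      0 < ((M.P g a ^ d : Matrix.rowStochastic ℝ S) : Matrix S S ℝ) i j := by
  refine pow_pos_iff_of_pos_iff (fun i j => ?_) d i j
  unfold P
  split_ifs <;> simp [hsupp]

lemma row_pos_iff (h g a : Fin K) (d : ℕ) (i j : S) :
    0 < row (M.P h a ^ d) i j ↔ 0 < row (M.P g a ^ d) i j := by
  simpa [row_apply] using P_pow_pos_iff hsupp h g a d i j

lemma firstObservation_pos_iff (h g a : Fin K) (x : S) :
    0 < M.firstObservation h a x ↔ 0 < M.firstObservation g a x := by
  simp only [pos_iff_ne_zero, firstObservation, ← PMF.mem_support_iff, PMF.mem_support_bind_iff]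
  simp only [PMF.mem_support_iff, ← pos_iff_ne_zero, row_pos_iff hsupp h g]

end Support

lemma expect_selectionOfHistory_fst (π : Policy K S) (H : History K S) (f : Fin K → ℝ≥0∞) :
    (expect (M.selectionOfHistory π H) fun c => f c.1) = expect (π.declare H) f := by
  simp only [selectionOfHistory, expect_bind, expect_map, expect_const]

variable [NeZero K]

lemma lintegral_historyAt_only (π : Policy K S) (h : Fin K) (m : ℕ) (f : History K S → ℝ≥0∞) :
    ∫⁻ ω, f (historyAt ω m) ∂M.law π h = expect (M.historyPMF π h m) f := by
  rw [M.lintegral_historyAt π h m fun H _ => f H]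
  simp only [expect_const]

open Classical in
lemma law_declaresAt (π : Policy K S) (h g : Fin K) (m : ℕ) :
    M.law π h {ω | DeclaresAt π m g ω} = expect (M.historyPMF π h m) fun H =>
      if π.stops H ∧ ¬ H.StoppedBefore π then π.declare H g else 0 := by
  let F : History K S → Fin K → ℝ≥0∞ := fun H g' =>
    if (π.stops H ∧ ¬ H.StoppedBefore π) ∧ g' = g then 1 else 0
  rw [← lintegral_indicator_one (measurableSet_declaresAt π m g)]
  refine (lintegral_congr fun ω => ?_).trans <|
    (M.lintegral_historyAt π h m fun H s => F H s.guess).trans ?_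
  · simp only [F, Set.indicator_apply, Set.mem_ofPred_eq, DeclaresAt, Pi.one_apply]
  refine expect_congr _ fun H _ => ?_
  change (expect (M.armStates h H) fun _ => expect (M.selectionOfHistory π H) fun c => F H c.1) = _
  rw [expect_const, expect_selectionOfHistory_fst]
  by_cases hs : π.stops H ∧ ¬ H.StoppedBefore π <;> simp [F, hs, expect]

/-! ### Change of measure -/

lemma llr_antisymm (h g : Fin K) (H : History K S) : M.llr h g H = - M.llr g h H := by
  induction H with
  | start x =>
    simp only [llr, ← Finset.sum_neg_distrib, ← Real.log_inv, inv_div]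
  | next H b a x ih =>
    simp only [llr, ih, neg_add, ← Real.log_inv, inv_div]

variable {M}
variable (hsupp : ∀ i j : S, 0 < (M.P₁ : Matrix S S ℝ) i j ↔ 0 < (M.P₂ : Matrix S S ℝ) i j)
include hsupp

/-- The factors for the intended and pulled arms are the same under both hypotheses; only the
observation factors differ, and their common support makes the change of measure exact. -/
lemma expect_historyPMF_eq (π : Policy K S) (h g : Fin K) (m : ℕ) (f : History K S → ℝ≥0∞) :
    expect (M.historyPMF π h m) f = expect (M.historyPMF π g m) fun H =>
      ENNReal.ofReal (Real.exp (M.llr h g H)) * f H := by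
  induction m generalizing f with
  | zero =>
    simp only [historyPMF, expect_map]
    refine tsum_congr fun x => ?_
    rw [← mul_assoc]
    congr 1
    simp only [prodPMF_apply, llr, Real.exp_sum]
    rw [ENNReal.ofReal_prod_of_nonneg fun a _ => (Real.exp_pos _).le, ← Finset.prod_mul_distrib]
    refine Finset.prod_congr rfl fun a _ => (exp_log_toReal_div ?_ ?_ ?_).symm
    · exact PMF.apply_ne_top _ _
    · exact PMF.apply_ne_top _ _
    · exact firstObservation_pos_iff hsupp h g a _
  | succ m ih =>
    simp only [historyPMF, expect_bind]
    rw [ih]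
    refine expect_congr _ fun H _ => ?_
    simp only [nextHistory, expect_bind, expect_map, ← expect_mul_left]
    refine expect_congr _ fun b _ => expect_congr _ fun a _ => tsum_congr fun x => ?_
    have key := exp_log_toReal_div (PMF.apply_ne_top _ _) (PMF.apply_ne_top _ _)
      (row_pos_iff hsupp h g a (H.delayState.delay a) (H.delayState.last a) x)
    rw [toReal_row, toReal_row] at key
    simp only [llr, Real.exp_add]
    rw [ENNReal.ofReal_mul (Real.exp_pos _).le]
    conv_lhs => rw [← key]
    ring

/-- When another arm than the declared one is the odd one, the declaration is unlikely. -/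
lemma law_declares_le {L : ℝ} (hKL : 0 < ((K : ℝ) - 1) * L)
    (lam : Fin K → DelayState K S → PMF (Fin K)) {h g : Fin K} (hne : h ≠ g) :
    M.law (M.piStar L lam) h {ω | (M.piStar L lam).declares ω g} ≤
      ENNReal.ofReal ((((K : ℝ) - 1) * L)⁻¹) := by
  classical
  set π := M.piStar L lam
  set c := ENNReal.ofReal ((((K : ℝ) - 1) * L)⁻¹)
  have hset : {ω | π.declares ω g} = ⋃ m, {ω | DeclaresAt π m g ω} := by
    ext ω
    simp [declares_iff]
  have hlaw : ∀ h', M.law π h' {ω | π.declares ω g} =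
      ∑' m, M.law π h' {ω | DeclaresAt π m g ω} := fun h' => by
    rw [hset, measure_iUnion (pairwise_disjoint_declaresAt π g)
      fun m => measurableSet_declaresAt π m g]
  calc M.law π h {ω | π.declares ω g}
      = ∑' m, M.law π h {ω | DeclaresAt π m g ω} := hlaw h
    _ ≤ ∑' m, c * M.law π g {ω | DeclaresAt π m g ω} := by
        refine ENNReal.tsum_le_tsum fun m => ?_
        rw [law_declaresAt, law_declaresAt, expect_historyPMF_eq hsupp π h g, ← expect_mul_left]
        refine expect_mono _ fun H => ?_
        split_ifs with hs
        swap; · simp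
        -- Only a maximiser can be declared, so the threshold reached by some maximiser `g'` is also
        -- reached by `g`.
        by_cases hg : π.declare H g = 0
        · simp [hg]
        refine mul_le_mul_left (ENNReal.ofReal_le_ofReal ?_) _
        have hmem : g ∈ M.bestArms H := by
          exact (PMF.mem_support_uniformOfFinset_iff (M.bestArms_nonempty H) g).1
            ((PMF.mem_support_iff _ _).2 hg)
        obtain ⟨⟨g', hg', hlog⟩, -⟩ := hs
        have h1 : M.minLlr g' H ≤ M.minLlr g H := by
          simp only [bestArms, Finset.mem_filter] at hmem
          exact hmem.2 g'
        have h2 : M.minLlr g H ≤ M.llr g h H :=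
          ciInf_le (Finite.bddBelow_range _) (⟨h, hne⟩ : {h' : Fin K // h' ≠ g})
        rw [M.llr_antisymm, Real.exp_neg]
        refine inv_anti₀ hKL ?_
        rw [← Real.log_le_iff_le_exp hKL]
        exact hlog.trans (h1.trans h2)
    _ = c * M.law π g {ω | π.declares ω g} := by rw [ENNReal.tsum_mul_left, hlaw g]
    _ ≤ c * 1 := by gcongr; exact prob_le_one
    _ = c := mul_one c

end Model

/-! ### Overlap of rows of transition matrices -/

section Overlap

variable {S : Type*} [Fintype S] [DecidableEq S]

/-- The geometric mean of two transition probabilities. -/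
def overlap (P Q : Matrix.rowStochastic ℝ S) (i x : S) : ℝ≥0∞ :=
  ENNReal.ofReal √((P : Matrix S S ℝ) i x * (Q : Matrix S S ℝ) i x)

lemma sqrt_mul_le_half_add {p q : ℝ} (hp : 0 ≤ p) (hq : 0 ≤ q) : √(p * q) ≤ (p + q) / 2 := by
  rw [Real.sqrt_le_iff]
  exact ⟨by positivity, by nlinarith [sq_nonneg (p - q)]⟩

lemma sqrt_mul_lt_half_add {p q : ℝ} (hp : 0 ≤ p) (hq : 0 ≤ q) (hne : p ≠ q) :
    √(p * q) < (p + q) / 2 := by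
  have h1 : 0 < (p - q) ^ 2 := by have := sub_ne_zero.2 hne; positivity
  rw [Real.sqrt_lt' (by
    rcases hp.eq_or_lt with rfl | hp
    · have := hq.lt_of_ne hne; positivity
    · positivity)]
  nlinarith

lemma sum_half_add_eq_one (P Q : Matrix.rowStochastic ℝ S) (i : S) :
    ∑ x, ((P : Matrix S S ℝ) i x + (Q : Matrix S S ℝ) i x) / 2 = 1 := by
  rw [← Finset.sum_div, Finset.sum_add_distrib, Matrix.sum_row_of_mem_rowStochastic P.2,
    Matrix.sum_row_of_mem_rowStochastic Q.2]
  norm_num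

/-- The inequality of arithmetic and geometric means, summed over the row. -/
lemma tsum_overlap_le_one (P Q : Matrix.rowStochastic ℝ S) (i : S) :
    ∑' x, overlap P Q i x ≤ 1 := by
  rw [tsum_fintype]
  unfold overlap
  rw [← ENNReal.ofReal_sum_of_nonneg fun x _ => Real.sqrt_nonneg _, ENNReal.ofReal_le_one,
    ← sum_half_add_eq_one P Q i]
  exact Finset.sum_le_sum fun x _ => sqrt_mul_le_half_add (entry_nonneg P i x) (entry_nonneg Q i x)

lemma tsum_overlap_lt_one {P Q : Matrix.rowStochastic ℝ S} {i j : S}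
    (hne : (P : Matrix S S ℝ) i j ≠ (Q : Matrix S S ℝ) i j) : ∑' x, overlap P Q i x < 1 := by
  rw [tsum_fintype]
  unfold overlap
  rw [← ENNReal.ofReal_sum_of_nonneg fun x _ => Real.sqrt_nonneg _, ENNReal.ofReal_lt_one,
    ← sum_half_add_eq_one P Q i]
  exact Finset.sum_lt_sum
    (fun x _ => sqrt_mul_le_half_add (entry_nonneg P i x) (entry_nonneg Q i x))
    ⟨j, Finset.mem_univ j, sqrt_mul_lt_half_add (entry_nonneg P i j) (entry_nonneg Q i j) hne⟩

lemma row_mul_exp_eq_overlap {P Q : Matrix.rowStochastic ℝ S} {i x : S}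
    (h : 0 < (P : Matrix S S ℝ) i x ↔ 0 < (Q : Matrix S S ℝ) i x) :
    row P i x * ENNReal.ofReal
      (Real.exp (-Real.log ((P : Matrix S S ℝ) i x / (Q : Matrix S S ℝ) i x) / 2)) =
      overlap P Q i x := by
  rw [row_apply, ← ENNReal.ofReal_mul (entry_nonneg P i x), overlap]
  congr 1
  rcases (entry_nonneg P i x).eq_or_lt with hp | hp
  · simp [← hp]
  -- Common support excludes `p > 0 = q`, where `log (p / 0) = 0` would leave `p` instead of `√(p q)
  -- = 0`.
  · have hq := h.1 hp
    set p := (P : Matrix S S ℝ) i x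
    set q := (Q : Matrix S S ℝ) i x
    rw [eq_comm, Real.sqrt_eq_iff_mul_self_eq (by positivity) (by positivity)]
    have h1 : Real.exp (-Real.log (p / q) / 2) * Real.exp (-Real.log (p / q) / 2) = q / p := by
      rw [← Real.exp_add, add_halves, Real.exp_neg, Real.exp_log (by positivity), inv_div]
    calc p * q = p * p * (q / p) := by field_simp
      _ = _ := by rw [← h1]; ring

end Overlap

/-! ### The log-likelihood ratios grow -/

namespace Model

variable {K : ℕ} {S : Type*} [Fintype S] [DecidableEq S] (M : Model K S)

lemma le_tremble (b a : Fin K) : ENNReal.ofReal (M.η / K) ≤ M.tremble b a := by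
  refine ENNReal.ofReal_le_ofReal ?_
  have := M.eta_le_one
  split_ifs <;> simp [this]

variable [NeZero K]

/-- The square root of the likelihood ratio of `h'` with respect to `h`. -/
def sqrtLikelihood (h h' : Fin K) (H : History K S) : ℝ≥0∞ :=
  ENNReal.ofReal (Real.exp (-M.llr h h' H / 2))

/-- The conditional expectation, given the history, of a function of the next history. -/
def nextExpect (π : Policy K S) (h : Fin K) (f : History K S → ℝ≥0∞) (H : History K S) : ℝ≥0∞ :=
  expect (M.nextHistory π h H) f

lemma nextExpect_eq (π : Policy K S) (h : Fin K) (f : History K S → ℝ≥0∞) (H : History K S) :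
    M.nextExpect π h f H = expect (π.pull H) fun b => expect (M.tremble b) fun a =>
      expect (row (M.P h a ^ H.delayState.delay a) (H.delayState.last a)) fun x =>
        f (H.next b a x) := by
  simp only [nextExpect, nextHistory, expect_bind, expect_map]

lemma monotone_nextExpect (π : Policy K S) (h : Fin K) : Monotone (M.nextExpect π h) :=
  fun _ _ hfg _ => expect_mono _ hfg

lemma expect_historyPMF_add (π : Policy K S) (h : Fin K) (m k : ℕ) (f : History K S → ℝ≥0∞) :
    expect (M.historyPMF π h (m + k)) f =
      expect (M.historyPMF π h m) ((M.nextExpect π h)^[k] f) := by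
  induction k generalizing f with
  | zero => rfl
  | succ k ih =>
    rw [← add_assoc, historyPMF, expect_bind, Function.iterate_succ_apply, ← ih]
    rfl

lemma eta_div_ne_zero : ENNReal.ofReal (M.η / K) ≠ 0 := by
  have h1 := M.eta_pos
  have h2 : 0 < (K : ℝ) := by exact_mod_cast Nat.pos_of_ne_zero (NeZero.ne K)
  simp only [ne_eq, ENNReal.ofReal_eq_zero, not_le]
  positivity

/-- Chernoff's bound with exponent `1 / 2`. -/
lemma law_llr_lt_le (π : Policy K S) (h h' : Fin K) (m : ℕ) (r : ℝ) :
    M.law π h {ω | M.llr h h' (historyAt ω m) < r} ≤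
      ENNReal.ofReal (Real.exp (r / 2)) *
        expect (M.historyPMF π h m) (M.sqrtLikelihood h h') := by
  rw [← expect_mul_left, ← lintegral_historyAt_only]
  refine le_trans (measure_mono fun ω hω => ?_) <| (one_mul _).symm.le.trans
    (mul_meas_ge_le_lintegral (measurable_historyAt m fun H _ =>
      ENNReal.ofReal (Real.exp (r / 2)) * M.sqrtLikelihood h h' H) 1)
  have hω' : M.llr h h' (historyAt ω m) < r := hω
  change 1 ≤ ENNReal.ofReal (Real.exp (r / 2)) * M.sqrtLikelihood h h' (historyAt ω m)
  rw [sqrtLikelihood, ← ENNReal.ofReal_mul (Real.exp_pos _).le, ← Real.exp_add,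
    ENNReal.one_le_ofReal, Real.one_le_exp_iff]
  linarith

/-- If state `i` of arm `h` has just been observed, a number of further observations that depends
only on `i` reduces the expected square root of the likelihood ratio by a constant factor. -/
def ContractsFrom (π : Policy K S) (h h' : Fin K) (i : S) : Prop :=
  ∃ k, ∃ c < 1, ∀ H : History K S, H.delayState.delay h = 1 → H.delayState.last h = i →
    (M.nextExpect π h)^[k] (M.sqrtLikelihood h h') H ≤ c * M.sqrtLikelihood h h' H

variable {M}
variable (hsupp : ∀ i j : S, 0 < (M.P₁ : Matrix S S ℝ) i j ↔ 0 < (M.P₂ : Matrix S S ℝ) i j)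
include hsupp

/-- Because `p * √(q / p) = √(p q)`. The weight `f` allows a further contraction to be inserted at
one particular observed state. -/
lemma expect_sqrtLikelihood_next (h h' : Fin K) (H : History K S) (b a : Fin K) (f : S → ℝ≥0∞) :
    (expect (row (M.P h a ^ H.delayState.delay a) (H.delayState.last a)) fun x =>
      f x * M.sqrtLikelihood h h' (H.next b a x)) =
    (∑' x, overlap (M.P h a ^ H.delayState.delay a) (M.P h' a ^ H.delayState.delay a)
      (H.delayState.last a) x * f x) * M.sqrtLikelihood h h' H := by
  rw [expect, ← ENNReal.tsum_mul_right]
  refine tsum_congr fun x => ?_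
  rw [← row_mul_exp_eq_overlap (P_pow_pos_iff hsupp h h' a _ _ x)]
  simp only [sqrtLikelihood, llr, neg_add, add_div, Real.exp_add]
  rw [ENNReal.ofReal_mul (Real.exp_pos _).le]
  ring

lemma expect_sqrtLikelihood_next_le (h h' : Fin K) (H : History K S) (b a : Fin K) :
    (expect (row (M.P h a ^ H.delayState.delay a) (H.delayState.last a)) fun x =>
      M.sqrtLikelihood h h' (H.next b a x)) ≤ M.sqrtLikelihood h h' H := by
  have := expect_sqrtLikelihood_next hsupp h h' H b a fun _ => 1
  simp only [one_mul, mul_one] at this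
  rw [this]
  exact mul_le_of_le_one_left' (tsum_overlap_le_one _ _ _)

/-- A contraction on the event that arm `h` is pulled gives a contraction. -/
lemma nextExpect_le_mul (π : Policy K S) (h h' : Fin K) {f : History K S → ℝ≥0∞}
    (hf : f ≤ M.sqrtLikelihood h h') {c : ℝ≥0∞} (hc : c ≤ 1) {H : History K S}
    (hcH : ∀ b, (expect (row (M.P h h ^ H.delayState.delay h) (H.delayState.last h)) fun x =>
      f (H.next b h x)) ≤ c * M.sqrtLikelihood h h' H) :
    M.nextExpect π h f H ≤
      (1 - ENNReal.ofReal (M.η / K) * (1 - c)) * M.sqrtLikelihood h h' H := by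
  rw [nextExpect_eq]
  refine le_trans (expect_mono _ fun b => ?_) (expect_const (π.pull H) _).le
  calc _ ≤ expect (M.tremble b) fun a =>
        M.sqrtLikelihood h h' H * if a = h then c else 1 := by
        refine expect_mono _ fun a => ?_
        split_ifs with ha
        · subst ha
          rw [mul_comm]
          exact hcH b
        · rw [mul_one]
          exact (expect_mono _ fun x => hf _).trans
            (expect_sqrtLikelihood_next_le hsupp h h' H b a)
    _ ≤ _ := by
        rw [expect_mul_left, mul_comm]
        gcongr
        refine tsum_mul_le_of_le_apply (M.tremble b).tsum_coe.le (M.le_tremble b h) hc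
          (fun a => ?_) (by simp)
        split_ifs
        · exact hc
        · exact le_rfl

lemma nextExpect_sqrtLikelihood_le (π : Policy K S) (h h' : Fin K) :
    M.nextExpect π h (M.sqrtLikelihood h h') ≤ M.sqrtLikelihood h h' := fun H => by
  have := nextExpect_le_mul hsupp π h h' le_rfl le_rfl (H := H) fun b => by
    rw [one_mul]; exact expect_sqrtLikelihood_next_le hsupp h h' H b h
  simpa using this

lemma antitone_iterate_nextExpect (π : Policy K S) (h h' : Fin K) :
    Antitone fun k => (M.nextExpect π h)^[k] (M.sqrtLikelihood h h') :=
  (M.monotone_nextExpect π h).antitone_iterate_of_map_le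
    (nextExpect_sqrtLikelihood_le hsupp π h h')

/-- One step suffices: arm `h` is pulled with probability at least `η / K`, and at delay `1` the
rows compared are those of `P₁` and `P₂` themselves. -/
lemma contractsFrom_of_ne (π : Policy K S) {h h' : Fin K} (hne : h' ≠ h) {i j : S}
    (hij : (M.P₁ : Matrix S S ℝ) i j ≠ (M.P₂ : Matrix S S ℝ) i j) :
    M.ContractsFrom π h h' i := by
  have hlt := tsum_overlap_lt_one hij
  refine ⟨1, _, one_sub_mul_one_sub_lt_one M.eta_div_ne_zero hlt, fun H hd hl =>
    nextExpect_le_mul hsupp π h h' le_rfl hlt.le fun b => ?_⟩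
  have := expect_sqrtLikelihood_next hsupp h h' H b h fun _ => 1
  simp only [one_mul, mul_one] at this
  rw [this, hd, hl]
  simp [P, hne.symm]

/-- Pulling arm `h` again leads to `j` with positive overlap weight, and the contraction from `j`
acts on that share; no other outcome increases the expectation. -/
lemma ContractsFrom.of_pos (π : Policy K S) {h h' : Fin K} (hne : h' ≠ h) {i j : S}
    (hij : 0 < (M.P₁ : Matrix S S ℝ) i j) (hj : M.ContractsFrom π h h' j) :
    M.ContractsFrom π h h' i := by
  obtain ⟨k, c, hc, hk⟩ := hj
  have hov : overlap M.P₁ M.P₂ i j ≠ 0 := by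
    have := (hsupp i j).1 hij
    simp only [overlap, ne_eq, ENNReal.ofReal_eq_zero, not_le]
    positivity
  have hlt := one_sub_mul_one_sub_lt_one hov hc
  have hle : (M.nextExpect π h)^[k] (M.sqrtLikelihood h h') ≤ M.sqrtLikelihood h h' :=
    antitone_iterate_nextExpect hsupp π h h' (Nat.zero_le k)
  refine ⟨k + 1, _, one_sub_mul_one_sub_lt_one M.eta_div_ne_zero hlt, fun H hd hl => ?_⟩
  rw [Function.iterate_succ_apply']
  refine nextExpect_le_mul hsupp π h h' hle hlt.le fun b => ?_
  calc _ ≤ expect (row (M.P h h ^ H.delayState.delay h) (H.delayState.last h)) fun x =>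
        (if x = j then c else 1) * M.sqrtLikelihood h h' (H.next b h x) := by
        refine expect_mono _ fun x => ?_
        split_ifs with hx
        · exact hk _ (by simp [History.delayState, DelayState.update, DelayState.delay])
            (by simp [History.delayState, DelayState.update, DelayState.last, hx])
        · rw [one_mul]
          exact hle _
    _ ≤ _ := by
        rw [expect_sqrtLikelihood_next hsupp]
        gcongr
        rw [hd, hl]
        simp only [pow_one, P, if_true, if_neg hne.symm]
        refine tsum_mul_le_of_le_apply (tsum_overlap_le_one _ _ _) le_rfl hc.le
          (fun x => ?_) (by simp)
        split_ifs
        · exact hc.le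
        · exact le_rfl

lemma ContractsFrom.of_pow_pos (π : Policy K S) {h h' : Fin K} (hne : h' ≠ h) {i j : S} (n : ℕ)
    (hij : 0 < ((M.P₁ : Matrix S S ℝ) ^ n) i j) (hj : M.ContractsFrom π h h' j) :
    M.ContractsFrom π h h' i := by
  induction n generalizing i with
  | zero =>
    by_cases h0 : i = j
    · exact h0 ▸ hj
    · simp [h0] at hij
  | succ n ih =>
    rw [pow_succ', Matrix.mul_apply] at hij
    obtain ⟨k, -, hk⟩ := Finset.exists_ne_zero_of_sum_ne_zero hij.ne'
    have h1 := entry_nonneg M.P₁ i k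
    have h2 : 0 ≤ ((M.P₁ : Matrix S S ℝ) ^ n) k j := entry_nonneg (M.P₁ ^ n) k j
    exact (ih (h2.lt_of_ne' (right_ne_zero_of_mul hk))).of_pos hsupp π hne
      (h1.lt_of_ne' (left_ne_zero_of_mul hk))

/-- A fixed number of further observations reduces the expected square root of the likelihood ratio
by a constant factor, whatever the history. -/
lemma exists_contraction (hirr : (M.P₁ : Matrix S S ℝ).IsIrreducible) (hP : M.P₂ ≠ M.P₁)
    (π : Policy K S) {h h' : Fin K} (hne : h' ≠ h) :
    ∃ k, ∃ c < 1, ∀ H, (M.nextExpect π h)^[k] (M.sqrtLikelihood h h') H ≤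
      c * M.sqrtLikelihood h h' H := by
  obtain ⟨i₀, j₀, hij⟩ : ∃ i j, (M.P₁ : Matrix S S ℝ) i j ≠ (M.P₂ : Matrix S S ℝ) i j := by
    by_contra! hcon
    exact hP (Subtype.ext (Matrix.ext fun i j => (hcon i j).symm))
  have hall : ∀ i, M.ContractsFrom π h h' i := fun i => by
    obtain ⟨n, -, hn⟩ :=
      (Matrix.isIrreducible_iff_exists_pow_pos (entry_nonneg M.P₁)).1 hirr i i₀
    exact (contractsFrom_of_ne hsupp π hne hij).of_pow_pos hsupp π hne n hn
  choose k c hc hk using hall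
  set c₀ := Finset.univ.sup c
  have hc₀ : c₀ < 1 := (Finset.sup_lt_iff (by simp)).2 fun i _ => hc i
  set k₀ := Finset.univ.sup k
  -- The extra step pulls arm `h` at whatever delay it has, resetting that delay to `1`; `k₀`
  -- further steps serve every observed state, since iterating longer never increases the
  -- expectation.
  refine ⟨k₀ + 1, _, one_sub_mul_one_sub_lt_one M.eta_div_ne_zero hc₀, fun H => ?_⟩
  rw [Function.iterate_succ_apply']
  refine nextExpect_le_mul hsupp π h h'
    (antitone_iterate_nextExpect hsupp π h h' (Nat.zero_le k₀)) hc₀.le fun b => ?_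
  calc _ ≤ expect (row (M.P h h ^ H.delayState.delay h) (H.delayState.last h)) fun x =>
        c₀ * M.sqrtLikelihood h h' (H.next b h x) := by
        refine expect_mono _ fun x => ?_
        refine (antitone_iterate_nextExpect hsupp π h h'
          (Finset.le_sup (f := k) (Finset.mem_univ x)) _).trans ((hk x _ ?_ ?_).trans ?_)
        · simp [History.delayState, DelayState.update, DelayState.delay]
        · simp [History.delayState, DelayState.update, DelayState.last]
        · gcongr
          exact Finset.le_sup (f := c) (Finset.mem_univ x)
    _ ≤ _ := by
        rw [expect_mul_left]
        gcongr
        exact expect_sqrtLikelihood_next_le hsupp h h' H b h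

lemma tendsto_expect_sqrtLikelihood (hirr : (M.P₁ : Matrix S S ℝ).IsIrreducible)
    (hP : M.P₂ ≠ M.P₁) (π : Policy K S) {h h' : Fin K} (hne : h' ≠ h) :
    Filter.Tendsto (fun m => expect (M.historyPMF π h m) (M.sqrtLikelihood h h')) Filter.atTop
      (nhds 0) := by
  obtain ⟨k, c, hc, hk⟩ := exists_contraction hsupp hirr hP π hne
  set E := fun m => expect (M.historyPMF π h m) (M.sqrtLikelihood h h')
  -- Monotonicity extends the geometric decay along multiples of `k` to all times.
  have hanti : Antitone E := antitone_nat_of_succ_le fun m => by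
    simp only [E]
    rw [historyPMF, expect_bind]
    exact expect_mono _ (nextExpect_sqrtLikelihood_le hsupp π h h')
  have hstart : E 0 ≠ ∞ := by
    simp only [E, historyPMF, expect_map]
    rw [expect, tsum_fintype]
    exact ENNReal.sum_ne_top.2 fun x _ =>
      ENNReal.mul_ne_top (PMF.apply_ne_top _ _) ENNReal.ofReal_ne_top
  have hgeom : ∀ n, E (n * k) ≤ E 0 * c ^ n := by
    intro n
    induction n with
    | zero => simp
    | succ n ih =>
      calc E ((n + 1) * k) = expect (M.historyPMF π h (n * k))
            ((M.nextExpect π h)^[k] (M.sqrtLikelihood h h')) := by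
            rw [← expect_historyPMF_add, add_mul, one_mul]
        _ ≤ c * E (n * k) := by
            rw [← expect_mul_left]
            exact expect_mono _ hk
        _ ≤ c * (E 0 * c ^ n) := by gcongr
        _ = E 0 * c ^ (n + 1) := by ring
  have hlim : Filter.Tendsto (fun n => E 0 * c ^ n) Filter.atTop (nhds 0) := by
    simpa using ENNReal.Tendsto.const_mul (ENNReal.tendsto_pow_atTop_nhds_zero_of_lt_one hc)
      (Or.inr hstart)
  rw [ENNReal.tendsto_nhds_zero] at hlim ⊢
  intro r hr
  obtain ⟨n, hn⟩ := (hlim r hr).exists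
  exact Filter.eventually_atTop.2 ⟨n * k, fun m hm => (hanti hm).trans ((hgeom n).trans hn)⟩

/-- The policy stops with probability `1`. -/
lemma law_never_stops (hK : 2 ≤ K) (hirr : (M.P₁ : Matrix S S ℝ).IsIrreducible)
    (hP : M.P₂ ≠ M.P₁) (L : ℝ) (lam : Fin K → DelayState K S → PMF (Fin K)) (h : Fin K) :
    M.law (M.piStar L lam) h {ω | ¬ ∃ m, (M.piStar L lam).stops (historyAt ω m)} = 0 := by
  set π := M.piStar L lam
  set r := Real.log (((K : ℝ) - 1) * L)
  have : Nontrivial (Fin K) := Fin.nontrivial_iff_two_le.2 hK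
  -- If the policy has not stopped, even the best arm is below the threshold, hence so is `h`,
  -- through some `h'`. This holds at every `m`, so the bound may be sent to its limit `0`.
  have hbound : ∀ m, M.law π h {ω | ¬ ∃ m, π.stops (historyAt ω m)} ≤
      ∑ h' ∈ Finset.univ.erase h, ENNReal.ofReal (Real.exp (r / 2)) *
        expect (M.historyPMF π h m) (M.sqrtLikelihood h h') := by
    intro m
    refine le_trans (measure_mono (t := ⋃ h' ∈ Finset.univ.erase h,
      {ω | M.llr h h' (historyAt ω m) < r}) fun ω hω => ?_) <|
      (measure_biUnion_finset_le _ _).trans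
        (Finset.sum_le_sum fun h' _ => M.law_llr_lt_le π h h' m r)
    have hns : ¬ π.stops (historyAt ω m) := fun hs => hω ⟨m, hs⟩
    obtain ⟨g, hg⟩ := M.bestArms_nonempty (historyAt ω m)
    have h1 : M.minLlr h (historyAt ω m) ≤ M.minLlr g (historyAt ω m) := by
      simp only [bestArms, Finset.mem_filter] at hg
      exact hg.2 h
    have h2 : M.minLlr h (historyAt ω m) < r := by
      by_contra! hle
      exact hns ⟨g, hg, hle.trans h1⟩
    obtain ⟨h'', hh''⟩ := exists_ne h
    -- An infimum over an empty family of reals would be `0` and yield no witness.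
    have : Nonempty {h' : Fin K // h' ≠ h} := ⟨⟨h'', hh''⟩⟩
    obtain ⟨h', hh'⟩ := exists_lt_of_ciInf_lt h2
    exact Set.mem_biUnion (by simpa using h'.2) hh'
  refine le_antisymm (ge_of_tendsto' (x := Filter.atTop) ?_ hbound) zero_le
  simpa using tendsto_finsetSum (Finset.univ.erase h) fun h' hh' =>
    ENNReal.Tendsto.const_mul (a := ENNReal.ofReal (Real.exp (r / 2)))
      (tendsto_expect_sqrtLikelihood hsupp hirr hP π (Finset.ne_of_mem_erase hh'))
      (Or.inr ENNReal.ofReal_ne_top)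

end Model

end

end RestlessOddArm

/-! ### The error bound -/

theorem mainTheorem5 {K : ℕ} [NeZero K] (hK : 3 ≤ K)
    {S : Type*} [Fintype S] [DecidableEq S] (M : RestlessOddArm.Model K S)
    (hP₁ : RestlessOddArm.IsErgodic M.P₁) (hP₂ : RestlessOddArm.IsErgodic M.P₂)
    (hne : M.P₂ ≠ M.P₁)
    (hsupp : ∀ i j : S, 0 < (M.P₁ : Matrix S S ℝ) i j ↔ 0 < (M.P₂ : Matrix S S ℝ) i j)
    (ε : ℝ) (hε : 0 < ε) (L : ℝ) (hL : L = 1 / ε) (δ : ℝ) (hδ : 0 < δ)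
    (lam : Fin K → RestlessOddArm.DelayState K S → PMF (Fin K))
    (hlam : ∀ h, M.IsNearOptimal δ h (lam h)) :
    M.piStar L lam ∈ M.policiesWithError ε := by

  intro h
  set π := M.piStar L lam
  have hL0 : 0 < L := by rw [hL]; positivity
  have hK1 : 0 < (K : ℝ) - 1 := by
    have : (3 : ℝ) ≤ K := by exact_mod_cast hK
    linarith
  calc M.law π h {ω | ¬ π.declares ω h}
      ≤ M.law π h ({ω | ¬ ∃ m, π.stops (RestlessOddArm.historyAt ω m)} ∪
          ⋃ g ∈ Finset.univ.erase h, {ω | π.declares ω g}) := by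
        refine measure_mono fun ω hω => ?_
        by_cases hs : ∃ m, π.stops (RestlessOddArm.historyAt ω m)
        · obtain ⟨g, hg⟩ := RestlessOddArm.declares_or_of_stops π hs
          have hgh : g ≠ h := fun he => hω (he ▸ hg)
          exact Or.inr (Set.mem_biUnion (by simpa using hgh) hg)
        · exact Or.inl hs
    _ ≤ 0 + ∑ g ∈ Finset.univ.erase h, M.law π h {ω | π.declares ω g} := by
        refine (measure_union_le _ _).trans (add_le_add ?_ (measure_biUnion_finset_le _ _))
        exact (RestlessOddArm.Model.law_never_stops hsupp (by omega) hP₁.1 hne L lam h).le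
    _ ≤ ∑ _g ∈ Finset.univ.erase h, ENNReal.ofReal ((((K : ℝ) - 1) * L)⁻¹) := by
        rw [zero_add]
        exact Finset.sum_le_sum fun g hg => RestlessOddArm.Model.law_declares_le hsupp
          (by positivity) lam (Finset.ne_of_mem_erase hg).symm
    -- The factor `K - 1` in the threshold cancels the number of wrong arms.
    _ = ENNReal.ofReal ε := by
        rw [Finset.sum_const, Finset.card_erase_of_mem (Finset.mem_univ h), Finset.card_univ,
          Fintype.card_fin, nsmul_eq_mul, ← ENNReal.ofReal_natCast,
          ← ENNReal.ofReal_mul (Nat.cast_nonneg _), Nat.cast_sub (by omega), Nat.cast_one, hL]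
        congr 1
        field_simp
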